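/- Let $\mathbb P=\{1,2,3,\dots\}$ and let $\mathbb P^*$ be the set of words over $\mathbb P$. Let $\equiv$ denote Knuth equivalence on $\mathbb P^*$, the equivalence relation generated by $xacby\equiv xcaby$ for $a\le b<c$ and $xbacy\equiv xbcay$ for $a<b\le c$ (where $x,y$ are words and $a,b,c$ letters), and let $P(w)$ be the insertion tableau of $w$ under the Robinson–Schensted–Knuth correspondence (row insertion). For a word $u$ put $C(u)=\{w\in\mathbb P^* : uw\equiv wu\}$, and let $c_{n,m}(u)$ be the number of $w\in C(u)$ of length $n$ all of whose letters are at most $m$. **Theorem.** Let $u\in\mathbb P^*$ and let $r$ be a positive integer. Suppose that (a) for every $w\in C(u)$, the first $r$ rows of $P(w)$ only contain elements which are at most $r$; (b) for every $w\in C(u)$, the remaining rows can be any semistandard Young tableau with entries greater than $r$; that is, every semistandard Young tableau $T$ which has the same first $r$ rows as $P(w)$ and all of whose entries below row $r$ are greater than $r$ is of the form $T=P(w')$ for some $w'\in C(u)$. Then for every fixed $n\ge r$ there is a polynomial $p\in\mathbb Q[t]$ of degree $n-r$ such that $c_{n,m}(u)=p(m)$ for all $m\ge n$. Moreover, if $n>r$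 or $r=1$, then the leading coefficient of $p$ is $1/(n-r)!$. -/

import Mathlib

/-- Words over the alphabet of positive integers. -/
abbrev Word : Type := List ℕ+

/-- A single Knuth transposition `v → w`:
`x a c b y → x c a b y` with `a ≤ b < c`, or `x b a c y → x b c a y` with `a < b ≤ c`. -/
inductive KnuthTransposition : Word → Word → Prop
  | acb (x y : Word) (a b c : ℕ+) (hab : a ≤ b) (hbc : b < c) :
      KnuthTransposition (x ++ [a, c, b] ++ y) (x ++ [c, a, b] ++ y)
  | bac (x y : Word) (a b c : ℕ+) (hab : a < b) (hbc : b ≤ c) :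
      KnuthTransposition (x ++ [b, a, c] ++ y) (x ++ [b, c, a] ++ y)

/-- Knuth equivalence: the equivalence relation generated by Knuth transpositions. -/
def KnuthEquiv (v w : Word) : Prop :=
  Relation.EqvGen KnuthTransposition v w

/-- The centralizer `C(u) = {w | uw ≡ wu}` of `u` in the plactic monoid, as a set of words. -/
def placticCentralizer (u : Word) : Set Word :=
  {w | KnuthEquiv (u ++ w) (w ++ u)}

/-- `c_{n,m}(u)`: the number of words in `C(u)` of length `n` with all letters at most `m`
(a finite set). -/
noncomputable def centralizerCount (n m : ℕ) (u : Word) : ℕ :=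
  {w : Word | w ∈ placticCentralizer u ∧ w.length = n ∧ ∀ a ∈ w, (a : ℕ) ≤ m}.ncard

/-- Row insertion of `a` into a weakly increasing row: `a` replaces the leftmost entry that is
larger than `a`, which is returned as the bumped entry; if there is none, `a` is put at the
end of the row and nothing is bumped. -/
def insertIntoRow (a : ℕ) : List ℕ → List ℕ × Option ℕ
  | [] => ([a], none)
  | b :: R =>
    if a < b then (a :: R, some b)
    else (b :: (insertIntoRow a R).1, (insertIntoRow a R).2)

/-- Insertion of `a` into a tableau, given as the list of its rows from top to bottom: insert
into the first row, then insert the bumped entry, if any, into the remaining rows. -/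
def insertIntoTableau (a : ℕ) : List (List ℕ) → List (List ℕ)
  | [] => [[a]]
  | R :: T =>
    (insertIntoRow a R).1 ::
      match (insertIntoRow a R).2 with
      | none => T
      | some b => insertIntoTableau b T

/-- The insertion tableau `P(w)`, as the list of its (nonempty) rows: the letters of `w` are
inserted from left to right into the empty tableau. -/
def insertionTableau (w : Word) : List (List ℕ) :=
  (w.map PNat.val).foldl (fun T a => insertIntoTableau a T) []

/-- The list of (nonempty) rows, from top to bottom, of a semistandard Young tableau. -/
def SemistandardYoungTableau.rows {μ : YoungDiagram} (T : SemistandardYoungTableau μ) :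
    List (List ℕ) :=
  (List.range (μ.colLen 0)).map fun i => (List.range (μ.rowLen i)).map fun j => T i j

/-! ### Knuth equivalence is a congruence -/

namespace KnuthEquiv

/-! Column strictness makes every entry of `P(w)` below row `r` exceed `r`. So (b) says that
membership in `C(u)` depends only on the first `r` rows of `P(w)`
(`mem_placticCentralizer_of_take_eq`), and (a) says that for members these rows hold no large
letter, that is, none greater than `r`. An increasing relabelling of the large letters therefore
preserves membership, and the number `N k` of members of length `n` with a prescribed set of `k`
large letters depends only on `k`. Summing over these sets gives `∑ k, (m - r).choose k * N k`
(`ncard_eq_sum_choose`). One large letter already forces `r` nonempty rows of small letters, so `N k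
= 0` for `k > n - r`, and the coefficient of `t ^ (n - r)` is `N (n - r) / (n - r)!`.

It is nonzero because `n ⋯ 1` lies in `C(u)`. Its first `r` rows are those of `r ⋯ 1`, so it is
enough that `r ⋯ 1` commutes with `u` (`KnuthEquiv.column_append_readingWord`). Peel first columns
off `P(u)`: while a large letter remains, the first column contains `1, …, r`, and a decreasing word
commutes with each of its letters; afterwards only letters of `r ⋯ 1` are left. In the case `n > r`,
having `n - r` distinct large letters forces a one-column tableau, whose Knuth class is a single
word, so `N (n - r) = 1`. -/

theorem refl (w : Word) : KnuthEquiv w w := Relation.EqvGen.refl w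

theorem symm {v w : Word} (h : KnuthEquiv v w) : KnuthEquiv w v := Relation.EqvGen.symm _ _ h

theorem trans {u v w : Word} (h : KnuthEquiv u v) (h' : KnuthEquiv v w) : KnuthEquiv u w :=
  Relation.EqvGen.trans _ _ _ h h'

theorem append_append {v w : Word} (h : KnuthEquiv v w) (x y : Word) :
    KnuthEquiv (x ++ v ++ y) (x ++ w ++ y) := by
  induction h with
  | rel v w h =>
    apply Relation.EqvGen.rel
    cases h with
    | acb x' y' a b c hab hbc =>
      simpa using KnuthTransposition.acb (x ++ x') (y' ++ y) a b c hab hbc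
    | bac x' y' a b c hab hbc =>
      simpa using KnuthTransposition.bac (x ++ x') (y' ++ y) a b c hab hbc
  | refl v => exact refl _
  | symm v w _ ih => exact ih.symm
  | trans u v w _ _ ih ih' => exact ih.trans ih'

theorem append_left {v w : Word} (h : KnuthEquiv v w) (x : Word) :
    KnuthEquiv (x ++ v) (x ++ w) := by
  simpa using h.append_append x []

theorem append_right {v w : Word} (h : KnuthEquiv v w) (y : Word) :
    KnuthEquiv (v ++ y) (w ++ y) := by
  simpa using h.append_append [] y

theorem cons {v w : Word} (h : KnuthEquiv v w) (a : ℕ+) : KnuthEquiv (a :: v) (a :: w) :=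
  h.append_left [a]

theorem acb (y : Word) {a b c : ℕ+} (hab : a ≤ b) (hbc : b < c) :
    KnuthEquiv (a :: c :: b :: y) (c :: a :: b :: y) :=
  Relation.EqvGen.rel _ _ (KnuthTransposition.acb [] y a b c hab hbc)

theorem bac (y : Word) {a b c : ℕ+} (hab : a < b) (hbc : b ≤ c) :
    KnuthEquiv (b :: a :: c :: y) (b :: c :: a :: y) :=
  Relation.EqvGen.rel _ _ (KnuthTransposition.bac [] y a b c hab hbc)

theorem perm {v w : Word} (h : KnuthEquiv v w) : v.Perm w := by
  induction h with
  | rel v w h =>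
    cases h with
    | acb x y a b c _ _ =>
      exact ((List.Perm.swap c a [b]).append_left x).append_right y
    | bac x y a b c _ _ =>
      exact (((List.Perm.swap c a []).cons b).append_left x).append_right y
  | refl v => exact List.Perm.refl v
  | symm v w _ ih => exact ih.symm
  | trans u v w _ _ ih ih' => exact ih.trans ih'

/-- A strictly decreasing word is alone in its Knuth class. -/
theorem eq_of_pairwise_gt {v w : Word} (h : KnuthEquiv v w) (hw : w.Pairwise (· > ·)) :
    v = w := by
  -- The hypothesis is symmetrized so that the induction passes through symmetry and transitivity.
  -- The generators are excluded because both sides of each contain an ascent or a repetition.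
  have key : (v.Pairwise (· > ·) ∨ w.Pairwise (· > ·)) → v = w := by
    clear hw
    induction h with
    | rel v w h =>
      intro hvw
      exfalso
      cases h with
      | acb x y a b c hab hbc =>
        rcases hvw with h | h <;>
          simp only [List.append_assoc, List.pairwise_append, List.cons_append,
            List.pairwise_cons, List.mem_cons] at h <;> grind
      | bac x y a b c hab hbc =>
        rcases hvw with h | h <;>
          simp only [List.append_assoc, List.pairwise_append, List.cons_append,
            List.pairwise_cons, List.mem_cons] at h
        · exact lt_asymm (h.2.1.2.1 c (Or.inl rfl)) (hab.trans_le hbc)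
        · exact (h.2.1.1 c (Or.inl rfl)).not_ge hbc
    | refl v => exact fun _ => rfl
    | symm v w _ ih => exact fun h => (ih h.symm).symm
    | trans u v w _ _ ih ih' =>
      rintro (h | h)
      · obtain rfl := ih (Or.inl h)
        exact ih' (Or.inl h)
      · obtain rfl := ih' (Or.inr h)
        exact ih (Or.inr h)
  exact key (Or.inr hw)

end KnuthEquiv

theorem mem_placticCentralizer_of_knuthEquiv {u w w' : Word} (hw : w ∈ placticCentralizer u)
    (h : KnuthEquiv w w') : w' ∈ placticCentralizer u :=
  ((h.symm.append_left u).trans hw).trans (h.append_right u)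

/-! ### Reading words -/

section ReadingWord

variable {α : Type*}

/-- The row reading word of a tableau: its rows from bottom to top. -/
def readingWord : List (List α) → List α
  | [] => []
  | R :: T => readingWord T ++ R

theorem mem_readingWord {x : α} {T : List (List α)} :
    x ∈ readingWord T ↔ ∃ R ∈ T, x ∈ R := by
  induction T with
  | nil => simp [readingWord]
  | cons R T ih => simp [readingWord, ih, or_comm]

theorem readingWord_append (S T : List (List α)) :
    readingWord (S ++ T) = readingWord T ++ readingWord S := by
  induction S with
  | nil => simp [readingWord]
  | cons R S ih => simp [readingWord, ih]

end ReadingWord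

/-! ### Row insertion over a linear order -/

section Insertion

variable {α β : Type*} [LinearOrder α] [LinearOrder β]

/-- Row insertion into a row over a linear order. -/
def rowInsert (a : α) : List α → List α × Option α
  | [] => ([a], none)
  | b :: R =>
    if a < b then (a :: R, some b)
    else (b :: (rowInsert a R).1, (rowInsert a R).2)

/-- Row insertion into a tableau over a linear order. -/
def tableauInsert (a : α) : List (List α) → List (List α)
  | [] => [[a]]
  | R :: T =>
    (rowInsert a R).1 ::
      match (rowInsert a R).2 with
      | none => T
      | some b => tableauInsert b T

/-- The insertion tableau of a list over a linear order. -/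
def rsTableau (w : List α) : List (List α) :=
  w.foldl (fun T a => tableauInsert a T) []

theorem rsTableau_concat (w : List α) (a : α) :
    rsTableau (w ++ [a]) = tableauInsert a (rsTableau w) := by
  simp [rsTableau]

theorem rowInsert_map {f : α → β} (hf : StrictMono f) (a : α) (R : List α) :
    rowInsert (f a) (R.map f) = ((rowInsert a R).1.map f, (rowInsert a R).2.map f) := by
  induction R with
  | nil => simp [rowInsert]
  | cons b R ih =>
    simp only [List.map_cons, rowInsert, hf.lt_iff_lt]
    split_ifs <;> simp [ih]

theorem tableauInsert_map {f : α → β} (hf : StrictMono f) (a : α) (T : List (List α)) :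
    tableauInsert (f a) (T.map (List.map f)) = (tableauInsert a T).map (List.map f) := by
  induction T generalizing a with
  | nil => simp [tableauInsert]
  | cons R T ih =>
    simp only [List.map_cons, tableauInsert, rowInsert_map hf]
    rcases (rowInsert a R).2 with _ | b <;> simp [ih]

/-- Insertion only compares letters. This serves both to pass from `ℕ+` to `ℕ` and to relabel large
letters. -/
theorem rsTableau_map {f : α → β} (hf : StrictMono f) (w : List α) :
    rsTableau (w.map f) = (rsTableau w).map (List.map f) := by
  induction w using List.reverseRecOn with
  | nil => simp [rsTableau]
  | append_singleton w a ih =>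
    rw [List.map_append, List.map_singleton, rsTableau_concat, rsTableau_concat, ih,
      tableauInsert_map hf]

theorem rowInsert_eq_insertIntoRow (a : ℕ) (R : List ℕ) : rowInsert a R = insertIntoRow a R := by
  induction R with
  | nil => rfl
  | cons b R ih => simp only [rowInsert, insertIntoRow, ih]

theorem tableauInsert_eq_insertIntoTableau (a : ℕ) (T : List (List ℕ)) :
    tableauInsert a T = insertIntoTableau a T := by
  induction T generalizing a with
  | nil => rfl
  | cons R T ih =>
    simp only [tableauInsert, insertIntoTableau, rowInsert_eq_insertIntoRow]
    rcases (insertIntoRow a R).2 with _ | b <;> simp [ih]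

theorem insertionTableau_eq (w : Word) :
    insertionTableau w = (rsTableau w).map (List.map PNat.val) := by
  rw [← rsTableau_map (f := PNat.val) (fun _ _ h => h)]
  simp only [insertionTableau, rsTableau, tableauInsert_eq_insertIntoTableau]

/-! ### Tableaux as lists of rows -/

/-- `Below R S`: the row `S`, placed under the row `R`, is not longer than `R` and every entry
of `S` is larger than the entry above it. -/
def Below : List α → List α → Prop
  | _, [] => True
  | [], _ :: _ => False
  | a :: R, b :: S => a < b ∧ Below R S

/-- Semistandard tableaux as lists of (possibly empty) rows. -/
def IsTableau : List (List α) → Prop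
  | [] => True
  | R :: T => R.Pairwise (· ≤ ·) ∧ Below R (T.headD []) ∧ IsTableau T

@[simp] theorem below_nil (R : List α) : Below R [] := by cases R <;> trivial

@[simp] theorem nil_below {S : List α} : Below [] S ↔ S = [] := by cases S <;> simp [Below]

@[simp] theorem cons_below_cons {a b : α} {R S : List α} :
    Below (a :: R) (b :: S) ↔ a < b ∧ Below R S := Iff.rfl

theorem Below.trans {R S Q : List α} (h : Below R S) (h' : Below S Q) : Below R Q := by
  induction R generalizing S Q with
  | nil => simp_all
  | cons a R ih =>
    cases Q with
    | nil => simp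
    | cons c Q =>
      cases S with
      | nil => simp at h'
      | cons b S => exact ⟨h.1.trans h'.1, ih h.2 h'.2⟩

theorem Below.tail {R S : List α} (h : Below R S) : Below R.tail S.tail := by
  cases R <;> cases S <;> simp_all

theorem Below.length_le {R S : List α} (h : Below R S) : S.length ≤ R.length := by
  induction R generalizing S with
  | nil => simp_all
  | cons a R ih =>
    cases S with
    | nil => simp
    | cons b S => simpa using ih h.2

theorem Below.exists_lt {R S : List α} (h : Below R S) {x : α} (hx : x ∈ S) :
    ∃ y ∈ R, y < x := by
  induction R generalizing S with
  | nil => simp_all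
  | cons a R ih =>
    cases S with
    | nil => simp at hx
    | cons b S =>
      rcases List.mem_cons.1 hx with rfl | hx
      · exact ⟨a, by simp, h.1⟩
      · obtain ⟨y, hy, hyx⟩ := ih h.2 hx
        exact ⟨y, by simp [hy], hyx⟩

theorem Below.getElem_lt {R S : List α} (h : Below R S) (j : ℕ) (hj : j < S.length) :
    R[j]'(hj.trans_le h.length_le) < S[j] := by
  induction R generalizing S j with
  | nil =>
    obtain rfl := nil_below.1 h
    simp at hj
  | cons a R ih =>
    cases S with
    | nil => simp at hj
    | cons b S =>
      cases j with
      | zero => exact h.1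
      | succ j => simpa using ih h.2 j (by simpa using hj)

theorem IsTableau.below {R : List α} {T : List (List α)} (h : IsTableau (R :: T)) :
    ∀ S ∈ T, Below R S := by
  induction T generalizing R with
  | nil => simp
  | cons S T ih =>
    intro Q hQ
    have hRS : Below R S := h.2.1
    rcases List.mem_cons.1 hQ with rfl | hQ
    · exact hRS
    · exact hRS.trans (ih h.2.2 Q hQ)

theorem IsTableau.pairwise_below {T : List (List α)} (h : IsTableau T) : T.Pairwise Below := by
  induction T with
  | nil => simp
  | cons R T ih => exact List.pairwise_cons.2 ⟨h.below, ih h.2.2⟩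

theorem IsTableau.pairwise_le {T : List (List α)} (h : IsTableau T) :
    ∀ R ∈ T, R.Pairwise (· ≤ ·) := by
  induction T with
  | nil => simp
  | cons R T ih => exact List.forall_mem_cons.2 ⟨h.1, ih h.2.2⟩

theorem IsTableau.map_tail {T : List (List α)} (h : IsTableau T) :
    IsTableau (T.map List.tail) := by
  induction T with
  | nil => trivial
  | cons R T ih =>
    refine ⟨h.1.tail, ?_, ih h.2.2⟩
    cases T with
    | nil => simp
    | cons S T => simpa using h.2.1.tail

theorem mem_rowInsert {a x : α} {R : List α} (hx : x ∈ (rowInsert a R).1) : x = a ∨ x ∈ R := by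
  induction R with
  | nil => simpa [rowInsert] using hx
  | cons b R ih =>
    rw [rowInsert] at hx
    split_ifs at hx <;> grind

theorem lt_of_rowInsert_eq_some {a b : α} {R : List α} (h : (rowInsert a R).2 = some b) :
    a < b := by
  induction R with
  | nil => simp [rowInsert] at h
  | cons c R ih =>
    rw [rowInsert] at h
    split_ifs at h with hc
    · simp only [Option.some.injEq] at h
      exact h ▸ hc
    · exact ih h

theorem rowInsert_ne_nil (a : α) (R : List α) : (rowInsert a R).1 ≠ [] := by
  cases R with
  | nil => simp [rowInsert]
  | cons b R => rw [rowInsert]; split_ifs <;> simp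

theorem rowInsert_pairwise {a : α} {R : List α} (hR : R.Pairwise (· ≤ ·)) :
    (rowInsert a R).1.Pairwise (· ≤ ·) := by
  induction R with
  | nil => simp [rowInsert]
  | cons b R ih =>
    rw [List.pairwise_cons] at hR
    rw [rowInsert]
    split_ifs with hab
    · exact List.pairwise_cons.2 ⟨fun x hx => hab.le.trans (hR.1 x hx), hR.2⟩
    · refine List.pairwise_cons.2 ⟨fun x hx => ?_, ih hR.2⟩
      rcases mem_rowInsert hx with rfl | hx
      · exact not_lt.1 hab
      · exact hR.1 x hx

theorem rowInsert_below {a : α} {R S : List α} (h : Below R S) : Below (rowInsert a R).1 S := by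
  induction R generalizing S with
  | nil => simp_all
  | cons b R ih =>
    cases S with
    | nil => simp
    | cons c S =>
      rw [rowInsert]
      split_ifs with hab
      · exact ⟨hab.trans h.1, h.2⟩
      · exact ⟨h.1, ih h.2⟩

/-- The entry below the bumped `b` exceeds `b`, so `b` enters the next row weakly to the left of the
column it came from, where it is above nothing smaller and under something smaller. -/
theorem rowInsert_below_rowInsert {a b : α} {R S : List α} (h : Below R S)
    (hb : (rowInsert a R).2 = some b) : Below (rowInsert a R).1 (rowInsert b S).1 := by
  induction R generalizing S with
  | nil => simp [rowInsert] at hb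
  | cons c R ih =>
    have hab := lt_of_rowInsert_eq_some hb
    rw [rowInsert] at hb ⊢
    split_ifs at hb ⊢ with hac
    · simp only [Option.some.injEq] at hb
      subst hb
      cases S with
      | nil => simp [rowInsert, hac]
      | cons d S => simpa [rowInsert, h.1, hac] using h.2
    · have hcb : c < b := (not_lt.1 hac).trans_lt hab
      cases S with
      | nil => simp [rowInsert, hcb]
      | cons d S =>
        rw [rowInsert]
        split_ifs
        · exact ⟨hcb, rowInsert_below h.2⟩
        · exact ⟨h.1, ih h.2 hb⟩

theorem headD_tableauInsert (a : α) (T : List (List α)) :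
    (tableauInsert a T).headD [] = (rowInsert a (T.headD [])).1 := by
  cases T <;> simp [tableauInsert, rowInsert]

theorem IsTableau.tableauInsert {a : α} {T : List (List α)} (h : IsTableau T) :
    IsTableau (tableauInsert a T) := by
  induction T generalizing a with
  | nil => simp [_root_.tableauInsert, IsTableau]
  | cons R T ih =>
    rw [_root_.tableauInsert]
    refine ⟨rowInsert_pairwise h.1, ?_, ?_⟩
    · rcases hb : (rowInsert a R).2 with _ | b
      · exact rowInsert_below h.2.1
      · simpa only [headD_tableauInsert] using rowInsert_below_rowInsert h.2.1 hb
    · rcases (rowInsert a R).2 with _ | b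
      · exact h.2.2
      · exact ih h.2.2

theorem isTableau_rsTableau (w : List α) : IsTableau (rsTableau w) := by
  induction w using List.reverseRecOn with
  | nil => trivial
  | append_singleton w a ih => exact rsTableau_concat w a ▸ ih.tableauInsert

theorem tableauInsert_ne_nil {a : α} {T : List (List α)} (h : ∀ R ∈ T, R ≠ []) :
    ∀ R ∈ tableauInsert a T, R ≠ [] := by
  induction T generalizing a with
  | nil => simp [tableauInsert]
  | cons R T ih =>
    rw [List.forall_mem_cons] at h
    rw [tableauInsert]
    refine List.forall_mem_cons.2 ⟨rowInsert_ne_nil a R, ?_⟩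
    rcases (rowInsert a R).2 with _ | b
    · exact h.2
    · exact ih h.2

theorem ne_nil_of_mem_rsTableau (w : List α) : ∀ R ∈ rsTableau w, R ≠ [] := by
  induction w using List.reverseRecOn with
  | nil => simp [rsTableau]
  | append_singleton w a ih => exact rsTableau_concat w a ▸ tableauInsert_ne_nil ih

theorem tableauInsert_map_singleton {a : α} {l : List α} (h : (a :: l).Pairwise (· < ·)) :
    tableauInsert a (l.map fun x => [x]) = (a :: l).map fun x => [x] := by
  induction l generalizing a with
  | nil => simp [tableauInsert]
  | cons b l ih =>
    rw [List.pairwise_cons] at h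
    have hab : a < b := h.1 b (by simp)
    have := ih h.2
    simp only [List.map_cons] at this
    simp [tableauInsert, rowInsert, hab, this]

theorem rsTableau_of_pairwise_gt {w : List α} (h : w.Pairwise (· > ·)) :
    rsTableau w = w.reverse.map fun x => [x] := by
  induction w using List.reverseRecOn with
  | nil => simp [rsTableau]
  | append_singleton w a ih =>
    have h' := (List.pairwise_append.1 h).1
    rw [rsTableau_concat, ih h', tableauInsert_map_singleton]
    · simp
    · have := List.pairwise_reverse.2 h
      simpa using this

theorem IsTableau.pairwise_readingWord {T : List (List α)} (h : IsTableau T)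
    (hT : ∀ R ∈ T, R.length ≤ 1) : (readingWord T).Pairwise (· > ·) := by
  induction T with
  | nil => simp [readingWord]
  | cons R T ih =>
    rw [List.forall_mem_cons] at hT
    refine List.pairwise_append.2 ⟨ih h.2.2 hT.2, ?_, ?_⟩
    · match R, hT.1 with
      | [], _ => simp
      | [a], _ => simp
    · intro x hx y hy
      obtain ⟨S, hS, hxS⟩ := mem_readingWord.1 hx
      obtain ⟨z, hz, hzx⟩ := (h.below S hS).exists_lt hxS
      match R, hT.1 with
      | [], _ => simp at hy
      | [a], _ => simp_all

end Insertion

/-! ### Row insertion and Knuth equivalence -/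

namespace KnuthEquiv

/-- The small letter `b` travels left through the row, each exchange being a `bac` move witnessed by
the preceding row entry. -/
theorem cons_append_cons {b d : ℕ+} {Q : Word} (hb : b < d) (hQ : (d :: Q).Pairwise (· ≤ ·))
    (y : Word) : KnuthEquiv (d :: (Q ++ b :: y)) (d :: b :: (Q ++ y)) := by
  induction Q generalizing d with
  | nil => exact refl _
  | cons q Q ih =>
    rw [List.pairwise_cons] at hQ
    have hdq : d ≤ q := hQ.1 q (by simp)
    exact ((ih (hb.trans_le hdq) hQ.2).cons d).trans (bac (Q ++ y) hb hdq).symm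

theorem cons_append_column {d : ℕ+} {Q D : Word} (hD : (d :: D).Pairwise (· > ·))
    (hQ : (d :: Q).Pairwise (· ≤ ·)) : KnuthEquiv (d :: (Q ++ D)) (d :: (D ++ Q)) := by
  induction D generalizing d with
  | nil => simpa using refl _
  | cons b D ih =>
    rw [List.pairwise_cons] at hD hQ
    have hbd : b < d := hD.1 b (by simp)
    refine (cons_append_cons hbd (List.pairwise_cons.2 hQ) D).trans ((ih hD.2 ?_).cons d)
    -- Since `b < d`, the row stays weakly increasing when its head `d` is replaced by `b`, so `b`
    -- can serve as head for the next letter of the column.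
    exact List.pairwise_cons.2 ⟨fun x hx => hbd.le.trans (hQ.1 x hx), hQ.2⟩

theorem append_singleton_rowInsert {a b : ℕ+} {R : Word} (hR : R.Pairwise (· ≤ ·))
    (hb : (rowInsert a R).2 = some b) :
    KnuthEquiv (R ++ [a]) (b :: (rowInsert a R).1) := by
  induction R with
  | nil => simp [rowInsert] at hb
  | cons c R ih =>
    have hab := lt_of_rowInsert_eq_some hb
    rw [rowInsert] at hb ⊢
    split_ifs at hb ⊢ with hac
    · simp only [Option.some.injEq] at hb
      subst hb
      simpa using cons_append_cons hac hR []
    · rw [List.pairwise_cons] at hR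
      refine ((ih hR.2 hb).cons c).trans ?_
      have hcb : c < b := (not_lt.1 hac).trans_lt hab
      -- The bumped letter `b` must still pass `c`; the new head `e` with `c ≤ e < b` is the witness
      -- for an `acb` move.
      have hhead : ∃ e Q, (rowInsert a R).1 = e :: Q ∧ c ≤ e ∧ e < b := by
        cases R with
        | nil => simp [rowInsert] at hb
        | cons e R =>
          rw [rowInsert] at hb ⊢
          split_ifs at hb ⊢ with hae
          · exact ⟨a, R, rfl, not_lt.1 hac, hab⟩
          · exact ⟨e, _, rfl, hR.1 e (by simp), (not_lt.1 hae).trans_lt hab⟩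
      obtain ⟨e, Q, heq, hce, heb⟩ := hhead
      rw [heq]
      exact acb Q hce heb

theorem readingWord_tableauInsert {a : ℕ+} {T : List (List ℕ+)} (h : IsTableau T) :
    KnuthEquiv (readingWord T ++ [a]) (readingWord (tableauInsert a T)) := by
  induction T generalizing a with
  | nil => exact refl _
  | cons R T ih =>
    rw [tableauInsert, readingWord, readingWord, List.append_assoc]
    rcases hb : (rowInsert a R).2 with _ | b
    · have : (rowInsert a R).1 = R ++ [a] := by
        clear ih h
        induction R with
        | nil => rfl
        | cons c R ih =>
          rw [rowInsert] at hb ⊢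
          split_ifs at hb ⊢
          simp [ih hb]
      simpa only [this] using refl _
    · have h₁ := (append_singleton_rowInsert h.1 hb).append_left (readingWord T)
      have h₂ := (ih (a := b) h.2.2).append_right (rowInsert a R).1
      exact h₁.trans (by simpa using h₂)

/-- Every word is Knuth equivalent to the reading word of its insertion tableau. -/
theorem readingWord_rsTableau (w : Word) : KnuthEquiv w (readingWord (rsTableau w)) := by
  induction w using List.reverseRecOn with
  | nil => exact refl _
  | append_singleton w a ih =>
    rw [rsTableau_concat]
    exact (ih.append_right [a]).trans (readingWord_tableauInsert (isTableau_rsTableau w))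

theorem of_rsTableau_eq {v w : Word} (h : rsTableau v = rsTableau w) : KnuthEquiv v w :=
  (readingWord_rsTableau v).trans (h ▸ (readingWord_rsTableau w).symm)

/-! ### Columns commuting with words -/

/-- Moving `a` right past a letter of `D` needs a following letter that is at least `a` and smaller
than the one passed: the next letter of `D`, or finally the second copy of `a`. -/
theorem cons_append_cons_self {a : ℕ+} {D : Word} (hD : (D ++ [a]).Pairwise (· > ·))
    (y : Word) : KnuthEquiv (a :: (D ++ a :: y)) (D ++ a :: a :: y) := by
  induction D with
  | nil => exact refl _
  | cons c D ih =>
    rw [List.cons_append, List.pairwise_cons] at hD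
    refine trans ?_ ((ih hD.2).cons c)
    cases D with
    | nil => exact acb y le_rfl (hD.1 a (by simp))
    | cons b D =>
      have hab : a < b := (List.pairwise_cons.1 hD.2).1 a (by simp)
      exact acb (D ++ a :: y) hab.le (hD.1 b (by simp))

/-- The final `a` moves left past each letter of `D` by a `bac` move; the witness is the letter
before it, which is larger than the one passed and at most `a`. -/
theorem cons_append_singleton {p a : ℕ+} {D : Word} (hD : (p :: D).Pairwise (· > ·))
    (hpa : p ≤ a) : KnuthEquiv (p :: (D ++ [a])) (p :: a :: D) := by
  induction D generalizing p with
  | nil => exact refl _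
  | cons q D ih =>
    rw [List.pairwise_cons] at hD
    have hqp : q < p := hD.1 q (by simp)
    exact ((ih hD.2 (hqp.le.trans hpa)).cons p).trans (bac D hqp hpa)

/-- A strictly decreasing word commutes with each of its letters. -/
theorem cons_comm_of_mem {a : ℕ+} {D : Word} (hD : D.Pairwise (· > ·)) (ha : a ∈ D) :
    KnuthEquiv (a :: D) (D ++ [a]) := by
  obtain ⟨D₁, D₂, rfl⟩ := List.append_of_mem ha
  have h₁ : (D₁ ++ [a]).Pairwise (· > ·) := hD.sublist (by simp)
  have h₂ := (List.pairwise_append.1 hD).2.1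
  refine (cons_append_cons_self h₁ D₂).trans ?_
  simpa using (cons_append_singleton h₂ le_rfl).symm.append_left D₁

theorem append_comm_of_subset {c D : Word} (hD : D.Pairwise (· > ·)) (hc : c ⊆ D) :
    KnuthEquiv (c ++ D) (D ++ c) := by
  induction c with
  | nil => simpa using refl _
  | cons a c ih =>
    rw [List.cons_subset] at hc
    have := (cons_comm_of_mem hD hc.1).append_right c
    exact ((ih hc.2).cons a).trans (by simpa using this)

end KnuthEquiv

theorem pairwise_filterMap_head {T : List (List ℕ+)} (hT : T.Pairwise Below) :
    (T.filterMap List.head?).Pairwise (· < ·) := by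
  rw [List.pairwise_filterMap]
  refine hT.imp ?_
  rintro (_ | ⟨a, R⟩) (_ | ⟨b, S⟩) h <;> simp_all

/-- The reading word of a tableau factors through its first column. -/
theorem KnuthEquiv.readingWord_column {T : List (List ℕ+)} (hT : T.Pairwise Below)
    (hT' : ∀ R ∈ T, R.Pairwise (· ≤ ·)) :
    KnuthEquiv (readingWord T)
      ((T.filterMap List.head?).reverse ++ readingWord (T.map List.tail)) := by
  -- The bottom row is read first, so adding it prepends `d :: Q`; the column of the upper rows then
  -- moves left across `Q` to join `d`.
  induction T using List.reverseRecOn with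
  | nil => exact refl _
  | append_singleton T Q ih =>
    have hcol := pairwise_filterMap_head hT
    replace ih := ih (List.pairwise_append.1 hT).1 fun R hR => hT' R (by simp [hR])
    have hQ : Q.Pairwise (· ≤ ·) := hT' Q (by simp)
    rw [readingWord_append, List.map_append, readingWord_append]
    cases Q with
    | nil =>
      have hnil : List.filterMap List.head? [([] : List ℕ+)] = [] := rfl
      simpa [readingWord, List.filterMap_append, hnil] using ih
    | cons d Q =>
      have hd : (d :: (T.filterMap List.head?).reverse).Pairwise (· > ·) := by
        simpa using List.pairwise_reverse.2 hcol
      have h₁ := ih.append_left (d :: Q)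
      have h₂ := (KnuthEquiv.cons_append_column hd hQ).append_right
        (readingWord (T.map List.tail))
      simp only [List.append_assoc, List.cons_append] at h₁ h₂
      simpa [readingWord] using h₁.trans h₂

/-- Column strictness raises the lower bound by one per row. With `k = 0` and `j = r` this supplies
the entry condition in (b) for free. -/
theorem IsTableau.lt_of_mem_drop {T : List (List ℕ+)} (h : IsTableau T) {k : ℕ}
    (hk : ∀ x ∈ T.headD [], k < (x : ℕ)) (j : ℕ) :
    ∀ R ∈ T.drop j, ∀ x ∈ R, k + j < (x : ℕ) := by
  induction T generalizing k j with
  | nil => simp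
  | cons S T ih =>
    have hk' : ∀ x ∈ T.headD [], k + 1 < (x : ℕ) := by
      intro x hx
      obtain ⟨y, hy, hyx⟩ := h.2.1.exists_lt hx
      have h₁ : k < (y : ℕ) := hk y hy
      have h₂ : (y : ℕ) < x := hyx
      omega
    intro R hR x hx
    cases j with
    | zero =>
      rcases List.mem_cons.1 hR with rfl | hR
      · exact hk x hx
      · have := ih h.2.2 hk' 0 R (by simpa using hR) x hx
        omega
    | succ j =>
      have := ih h.2.2 hk' j R hR x hx
      omega

theorem IsTableau.ne_nil_of_mem_take {T : List (List ℕ+)} (h : IsTableau T) {r : ℕ}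
    {S : List ℕ+} (hS : S ∈ T.drop r) {x : ℕ+} (hx : x ∈ S) : ∀ R ∈ T.take r, R ≠ [] := by
  have hT := h.pairwise_below
  rw [← List.take_append_drop r T, List.pairwise_append] at hT
  rintro R hR rfl
  rw [nil_below.1 (hT.2.2 _ hR S hS)] at hx
  simp at hx

theorem length_filterMap_head {L : List (List ℕ+)} (h : ∀ R ∈ L, R ≠ []) :
    (L.filterMap List.head?).length = L.length := by
  induction L with
  | nil => rfl
  | cons R L ih =>
    rw [List.forall_mem_cons] at h
    obtain ⟨b, R, rfl⟩ := List.exists_cons_of_ne_nil h.1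
    simpa using ih h.2

/-- The first `r` rows of a tableau with an entry larger than `r`, if they have no such entry
themselves, have `r` distinct first entries. -/
theorem IsTableau.mem_filterMap_head {T : List (List ℕ+)} (h : IsTableau T) {r : ℕ}
    (hr : ∀ R ∈ T.take r, ∀ x ∈ R, (x : ℕ) ≤ r) {S : List ℕ+} (hS : S ∈ T) {x : ℕ+}
    (hx : x ∈ S) (hrx : r < (x : ℕ)) {a : ℕ+} (ha : (a : ℕ) ≤ r) :
    a ∈ T.filterMap List.head? := by
  have hSd : S ∈ T.drop r := by
    rw [← List.take_append_drop r T, List.mem_append] at hS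
    exact hS.resolve_left fun hS => absurd (hr S hS x hx) (by omega)
  have hne := h.ne_nil_of_mem_take hSd hx
  have hlen : (T.take r).length = r := by
    have := List.length_pos_of_mem hSd
    rw [List.length_drop] at this
    rw [List.length_take]
    omega
  set H := (T.take r).filterMap List.head? with hH
  have hHlen : H.length = r := by rw [hH, length_filterMap_head hne, hlen]
  have hnodup : H.Nodup :=
    (pairwise_filterMap_head (h.pairwise_below.sublist (List.take_sublist r T))).imp ne_of_lt
  obtain ⟨q, rfl⟩ : ∃ q : ℕ+, (q : ℕ) = r := ⟨⟨r, a.pos.trans_le ha⟩, rfl⟩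
  have hsub : H.toFinset ⊆ Finset.Icc 1 q := by
    intro b hb
    rw [List.mem_toFinset, hH, List.mem_filterMap] at hb
    obtain ⟨R, hR, hRb⟩ := hb
    rw [Finset.mem_Icc]
    exact ⟨one_le, hr R hR b (List.mem_of_head? hRb)⟩
  -- Pigeonhole: `r` distinct heads inside `{1, …, r}` fill it.
  have heq := Finset.eq_of_subset_of_card_le hsub (by
    rw [List.toFinset_card_of_nodup hnodup, hHlen, PNat.card_Icc]
    simp)
  have haH : a ∈ H := by
    rw [← List.mem_toFinset, heq, Finset.mem_Icc]
    exact ⟨one_le, ha⟩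
  rw [hH] at haH
  exact ((List.take_sublist _ T).filterMap List.head?).subset haH

/-- The column with entries `1, …, r` commutes with every tableau whose first `r` rows have no
entry larger than `r`. -/
theorem KnuthEquiv.column_append_readingWord {r : ℕ} (hr : 0 < r) {W : Word}
    (hW : W.Pairwise (· > ·)) (hWr : ∀ a : ℕ+, a ∈ W ↔ (a : ℕ) ≤ r) {T : List (List ℕ+)}
    (hT : IsTableau T) (hTr : ∀ R ∈ T.take r, ∀ x ∈ R, (x : ℕ) ≤ r) :
    KnuthEquiv (W ++ readingWord T) (readingWord T ++ W) := by
  induction hn : (readingWord T).length using Nat.strong_induction_on generalizing T with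
  | _ n ih =>
    by_cases hall : ∀ x ∈ readingWord T, (x : ℕ) ≤ r
    · exact (append_comm_of_subset hW fun x hx => (hWr x).2 (hall x hx)).symm
    · push Not at hall
      obtain ⟨x, hx, hrx⟩ := hall
      obtain ⟨S, hS, hxS⟩ := mem_readingWord.1 hx
      have hmem : ∀ a : ℕ+, (a : ℕ) ≤ r → a ∈ (T.filterMap List.head?).reverse := fun a ha =>
        List.mem_reverse.2 (hT.mem_filterMap_head hTr hS hxS hrx ha)
      have hfac := readingWord_column hT.pairwise_below hT.pairwise_le
      set c := (T.filterMap List.head?).reverse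
      have hc : c.Pairwise (· > ·) :=
        List.pairwise_reverse.2 (pairwise_filterMap_head hT.pairwise_below)
      have hlen := hfac.perm.length_eq
      have hpos : 0 < c.length := List.length_pos_of_mem (hmem 1 hr)
      rw [List.length_append] at hlen
      have hTr' : ∀ R ∈ (T.map List.tail).take r, ∀ x ∈ R, (x : ℕ) ≤ r := by
        rw [← List.map_take]
        intro R hR x hx
        obtain ⟨Q, hQ, rfl⟩ := List.mem_map.1 hR
        exact hTr Q hQ x (List.mem_of_mem_tail hx)
      have h₁ := (append_comm_of_subset hc fun a ha => hmem a ((hWr a).1 ha)).append_right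
        (readingWord (T.map List.tail))
      -- Removing the first column keeps the bound on the first `r` rows, as emptied rows are
      -- retained and row indices do not shift. The length drops because `c` contains `1`.
      have h₂ := (ih _ (by omega) hT.map_tail hTr' rfl).append_left c
      refine (hfac.append_left W).trans (trans ?_ (hfac.symm.append_right W))
      simp only [List.append_assoc] at h₁ h₂ ⊢
      exact h₁.trans h₂

/-! ### Tableaux as Mathlib's semistandard Young tableaux -/

/-- This lets (b) be applied to insertion tableaux. Rows must be nonempty because `rows` stops at
the last nonempty one. -/
theorem IsTableau.exists_semistandardYoungTableau {T : List (List ℕ)} (hT : IsTableau T)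
    (hne : ∀ R ∈ T, R ≠ []) :
    ∃ (μ : YoungDiagram) (S : SemistandardYoungTableau μ), S.rows = T := by
  have hanti : (T.map List.length).SortedGE := by
    refine List.Pairwise.sortedGE ?_
    rw [List.pairwise_map]
    exact hT.pairwise_below.imp fun h => h.length_le
  have hpos : ∀ x ∈ T.map List.length, 0 < x := by
    intro x hx
    obtain ⟨R, hR, rfl⟩ := List.mem_map.1 hx
    exact List.length_pos_iff.2 (hne R hR)
  set μ := YoungDiagram.ofRowLens (T.map List.length) hanti with hμ
  have hmem : ∀ {i j : ℕ}, (i, j) ∈ μ ↔ ∃ h : i < T.length, j < T[i].length := by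
    intro i j
    rw [hμ, YoungDiagram.mem_ofRowLens]
    simp
  have hentry : ∀ {i j : ℕ} (h : i < T.length) (h' : j < T[i].length),
      (T.getD i []).getD j 0 = T[i][j] := by
    intro i j h h'
    simp [h, h']
  let S : SemistandardYoungTableau μ :=
    { entry := fun i j => (T.getD i []).getD j 0
      row_weak' := by
        intro i j₁ j₂ hj hij
        obtain ⟨h, h'⟩ := hmem.1 hij
        rw [hentry h h', hentry h (hj.trans h')]
        exact List.pairwise_iff_getElem.1 (hT.pairwise_le _ (List.getElem_mem h)) _ _ _ _ hj
      col_strict' := by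
        intro i₁ i₂ j hi hij
        obtain ⟨h, h'⟩ := hmem.1 hij
        have hbelow := List.pairwise_iff_getElem.1 hT.pairwise_below i₁ i₂ (hi.trans h) h hi
        rw [hentry h h', hentry (hi.trans h) (h'.trans_le hbelow.length_le)]
        exact hbelow.getElem_lt j h'
      zeros' := by
        intro i j hij
        by_cases h : i < T.length
        · have h' : T[i].length ≤ j := not_lt.1 fun h' => hij (hmem.2 ⟨h, h'⟩)
          simp [h, h']
        · simp [not_lt.1 h] }
  refine ⟨μ, S, ?_⟩
  have hlens := YoungDiagram.rowLens_ofRowLens_eq_self (hw := hanti) hpos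
  rw [← hμ] at hlens
  have hcol : μ.colLen 0 = T.length := by
    rw [← YoungDiagram.length_rowLens, hlens, List.length_map]
  have hrow : ∀ (i : ℕ) (h : i < T.length), μ.rowLen i = T[i].length := by
    intro i h
    have := YoungDiagram.rowLen_ofRowLens (hw := hanti) ⟨i, by simpa using h⟩
    simpa using this
  rw [SemistandardYoungTableau.rows]
  refine List.ext_getElem (by simp [hcol]) fun i h₁ h₂ => ?_
  rw [List.getElem_map, List.getElem_range]
  refine List.ext_getElem (by simp [hrow i h₂]) fun j h₃ h₄ => ?_
  rw [List.getElem_map, List.getElem_range]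
  exact hentry h₂ h₄

theorem IsTableau.map {α β : Type*} [LinearOrder α] [LinearOrder β] {f : α → β}
    (hf : StrictMono f) {T : List (List α)} (hT : IsTableau T) :
    IsTableau (T.map (List.map f)) := by
  have hbelow : ∀ R S : List α, Below R S → Below (R.map f) (S.map f) := by
    intro R
    induction R with
    | nil => simp_all
    | cons a R ih =>
      rintro (_ | ⟨b, S⟩) h
      · simp
      · exact ⟨hf h.1, ih S h.2⟩
  induction T with
  | nil => trivial
  | cons R T ih =>
    refine ⟨List.pairwise_map.2 (hT.1.imp fun h => hf.monotone h), ?_, ih hT.2.2⟩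
    cases T with
    | nil => simp
    | cons S T => simpa using hbelow _ _ hT.2.1

theorem rsTableau_eq_of_insertionTableau_eq {v w : Word}
    (h : insertionTableau v = insertionTableau w) : rsTableau v = rsTableau w := by
  rw [insertionTableau_eq, insertionTableau_eq] at h
  exact List.map_injective_iff.2 (List.map_injective_iff.2 PNat.coe_injective) h

/-- Under the hypothesis that the rows below row `r` are arbitrary, membership in the centralizer
depends only on the first `r` rows of the insertion tableau. -/
theorem mem_placticCentralizer_of_take_eq {u : Word} {r : ℕ}
    (hb : ∀ w ∈ placticCentralizer u,
      ∀ (μ : YoungDiagram) (T : SemistandardYoungTableau μ),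
        T.rows.take r = (insertionTableau w).take r →
        (∀ R ∈ T.rows.drop r, ∀ x ∈ R, r < x) →
        ∃ w' ∈ placticCentralizer u, insertionTableau w' = T.rows)
    {w w' : Word} (hw : w ∈ placticCentralizer u)
    (h : (rsTableau w').take r = (rsTableau w).take r) : w' ∈ placticCentralizer u := by
  -- Apply (b) with `P(w')` itself as the tableau: the resulting `v` in the centralizer has `P(v) =
  -- P(w')`, hence is Knuth equivalent to `w'`.
  obtain ⟨μ, S, hS⟩ := ((isTableau_rsTableau w').map (f := PNat.val)
    fun _ _ h => h).exists_semistandardYoungTableau (by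
      intro R hR
      obtain ⟨Q, hQ, rfl⟩ := List.mem_map.1 hR
      simpa using ne_nil_of_mem_rsTableau w' Q hQ)
  obtain ⟨v, hv, hvS⟩ := hb w hw μ S
    (by rw [hS, insertionTableau_eq, ← List.map_take, ← List.map_take, h]) (by
      rw [hS, ← List.map_drop]
      intro R hR x hx
      obtain ⟨Q, hQ, rfl⟩ := List.mem_map.1 hR
      obtain ⟨y, hy, rfl⟩ := List.mem_map.1 hx
      have := (isTableau_rsTableau w').lt_of_mem_drop (k := 0) (fun x _ => x.pos) r Q hQ y hy
      simpa using this)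
  refine mem_placticCentralizer_of_knuthEquiv hv (KnuthEquiv.of_rsTableau_eq ?_)
  exact rsTableau_eq_of_insertionTableau_eq (by rw [hvS, hS, insertionTableau_eq])

theorem le_of_mem_take_rsTableau {r : ℕ} {w : Word}
    (ha : ∀ R ∈ (insertionTableau w).take r, ∀ x ∈ R, x ≤ r) :
    ∀ R ∈ (rsTableau w).take r, ∀ x ∈ R, (x : ℕ) ≤ r := by
  rw [insertionTableau_eq, ← List.map_take] at ha
  exact fun R hR x hx => ha _ (List.mem_map_of_mem hR) _ (List.mem_map_of_mem hx)

/-! ### Decreasing words -/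

/-- The word `n (n-1) ⋯ 1`. -/
def decreasingWord (n : ℕ) : Word := ((List.range n).map Nat.succPNat).reverse

theorem decreasingWord_pairwise (n : ℕ) : (decreasingWord n).Pairwise (· > ·) := by
  rw [decreasingWord, List.pairwise_reverse, List.pairwise_map]
  exact List.pairwise_lt_range.imp fun h => Nat.succPNat_lt_succPNat.2 h

theorem length_decreasingWord (n : ℕ) : (decreasingWord n).length = n := by
  simp [decreasingWord]

theorem mem_decreasingWord {n : ℕ} {a : ℕ+} : a ∈ decreasingWord n ↔ (a : ℕ) ≤ n := by
  rw [decreasingWord, List.mem_reverse, List.mem_map]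
  constructor
  · rintro ⟨i, hi, rfl⟩
    simpa [Nat.succ_le_iff] using hi
  · intro h
    refine ⟨a.natPred, ?_, PNat.succPNat_natPred a⟩
    have := PNat.natPred_add_one a
    rw [List.mem_range]
    omega

theorem eq_decreasingWord {n : ℕ} {w : Word} (hw : w.Pairwise (· > ·)) (hn : w.length = n)
    (h : ∀ a ∈ w, (a : ℕ) ≤ n) : w = decreasingWord n := by
  have hperm : w.Perm (decreasingWord n) :=
    (List.subperm_of_subset (hw.imp ne_of_gt)
      fun a ha => mem_decreasingWord.2 (h a ha)).perm_of_length_le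
      (by rw [length_decreasingWord, hn])
  exact hperm.eq_of_pairwise (fun a b _ _ h h' => absurd h (lt_asymm h')) hw
    (decreasingWord_pairwise n)

theorem rsTableau_decreasingWord (n : ℕ) :
    rsTableau (decreasingWord n) = (List.range n).map fun i => [Nat.succPNat i] := by
  rw [rsTableau_of_pairwise_gt (decreasingWord_pairwise n), decreasingWord, List.reverse_reverse,
    List.map_map]
  rfl

/-- As `u` commutes with itself, (a) bounds the first `r` rows of `P(u)`, which is what the column
needs in order to commute with it. -/
theorem decreasingWord_mem_placticCentralizer {u : Word} {r : ℕ} (hr : 0 < r)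
    (ha : ∀ w ∈ placticCentralizer u,
      ∀ R ∈ (insertionTableau w).take r, ∀ x ∈ R, x ≤ r) :
    decreasingWord r ∈ placticCentralizer u := by
  have hu : u ∈ placticCentralizer u := KnuthEquiv.refl _
  have hread := KnuthEquiv.readingWord_rsTableau u
  have hcomm := KnuthEquiv.column_append_readingWord hr (decreasingWord_pairwise r)
    (fun _ => mem_decreasingWord) (isTableau_rsTableau u) (le_of_mem_take_rsTableau (ha u hu))
  exact ((hread.append_right _).trans hcomm.symm).trans (hread.symm.append_left _)

/-! ### Large letters of words in the centralizer -/

/-- The set of letters of `w` that are larger than `r`. -/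
def largeLetters (r : ℕ) (w : Word) : Finset ℕ := (w.map PNat.val).toFinset.filter (r < ·)

theorem mem_largeLetters {r x : ℕ} {w : Word} :
    x ∈ largeLetters r w ↔ (∃ a ∈ w, (a : ℕ) = x) ∧ r < x := by
  simp [largeLetters]

theorem coe_mem_largeLetters {r : ℕ} {a : ℕ+} {w : Word} :
    (a : ℕ) ∈ largeLetters r w ↔ a ∈ w ∧ r < (a : ℕ) := by
  simp [mem_largeLetters]

theorem length_le_length_readingWord {L : List (List ℕ+)} (h : ∀ R ∈ L, R ≠ []) :
    L.length ≤ (readingWord L).length := by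
  induction L with
  | nil => simp
  | cons R L ih =>
    rw [List.forall_mem_cons] at h
    have := List.length_pos_iff.2 h.1
    have := ih h.2
    simp only [readingWord, List.length_append, List.length_cons]
    omega

theorem length_le_one_of_length_readingWord_le {L : List (List ℕ+)} (h : ∀ R ∈ L, R ≠ [])
    (hL : (readingWord L).length ≤ L.length) : ∀ R ∈ L, R.length ≤ 1 := by
  induction L with
  | nil => simp
  | cons R L ih =>
    rw [List.forall_mem_cons] at h
    have := List.length_pos_iff.2 h.1
    have := length_le_length_readingWord h.2
    simp only [readingWord, List.length_append, List.length_cons] at hL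
    exact List.forall_mem_cons.2 ⟨by omega, ih h.2 (by omega)⟩

/-- A word whose first `r` tableau rows have no large letter has at most `length - r` of them, if
it has one at all, and is strictly decreasing in case of equality. -/
theorem card_largeLetters_add_le {r : ℕ} (hr : 0 < r) {w : Word}
    (hw : ∀ R ∈ (rsTableau w).take r, ∀ x ∈ R, (x : ℕ) ≤ r) (hne : (largeLetters r w).Nonempty) :
    (largeLetters r w).card + r ≤ w.length ∧
      ((largeLetters r w).card + r = w.length → w.Pairwise (· > ·)) := by
  have hT := isTableau_rsTableau w
  have hread := KnuthEquiv.readingWord_rsTableau w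
  set T := rsTableau w
  have hlarge : ∀ x ∈ w, r < (x : ℕ) → ∃ R ∈ T.drop r, x ∈ R := by
    intro x hx hrx
    obtain ⟨R, hR, hxR⟩ := mem_readingWord.1 (hread.perm.mem_iff.1 hx)
    rw [← List.take_append_drop r T, List.mem_append] at hR
    exact ⟨R, hR.resolve_left fun hR => absurd (hw R hR x hxR) (by omega), hxR⟩
  obtain ⟨y, hy⟩ := hne
  obtain ⟨⟨x, hx, rfl⟩, hrx⟩ := mem_largeLetters.1 hy
  obtain ⟨S, hS, hxS⟩ := hlarge x hx hrx
  have hnil := hT.ne_nil_of_mem_take hS hxS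
  have hlen : (T.take r).length = r := by
    have := List.length_pos_of_mem hS
    rw [List.length_drop] at this
    rw [List.length_take]
    omega
  have hsum : w.length = (readingWord (T.drop r)).length + (readingWord (T.take r)).length := by
    rw [hread.perm.length_eq, ← List.length_append, ← readingWord_append, List.take_append_drop]
  have hcard : (largeLetters r w).card ≤ (readingWord (T.drop r)).length := by
    have hsub : largeLetters r w ⊆ ((readingWord (T.drop r)).map PNat.val).toFinset := by
      intro z hz
      obtain ⟨⟨a, ha, rfl⟩, hra⟩ := mem_largeLetters.1 hz
      rw [List.mem_toFinset]
      exact List.mem_map_of_mem (mem_readingWord.2 (hlarge a ha hra))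
    refine (Finset.card_le_card hsub).trans ((List.toFinset_card_le _).trans ?_)
    rw [List.length_map]
  have htake := length_le_length_readingWord hnil
  -- Equality leaves exactly `r` letters for the `r` nonempty upper rows, so these have length one,
  -- and then so have all rows below.
  refine ⟨by omega, fun heq => ?_⟩
  have hone := length_le_one_of_length_readingWord_le hnil (by omega)
  have hall : ∀ R ∈ T, R.length ≤ 1 := by
    intro R hR
    rw [← List.take_append_drop r T, List.mem_append] at hR
    rcases hR with hR | hR
    · exact hone R hR
    · obtain ⟨Q, hQ⟩ := List.exists_mem_of_length_pos (l := T.take r) (by omega)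
      have hpw := hT.pairwise_below
      rw [← List.take_append_drop r T, List.pairwise_append] at hpw
      exact (hpw.2.2 Q hQ R hR).length_le.trans (hone Q hQ)
  have hdec := hT.pairwise_readingWord hall
  exact (hread.eq_of_pairwise_gt hdec).symm ▸ hdec

/-! ### Relabelling large letters -/

/-- A strictly monotone relabelling that fixes the letters up to `r` and maps the next `#K`
letters onto `K`. -/
theorem exists_strictMono_relabelling {r m : ℕ} {K : Finset ℕ} (hK : K ⊆ Finset.Ioc r m)
    (hrm : r ≤ m) :
    ∃ f : ℕ+ → ℕ+, StrictMono f ∧ (∀ i : ℕ+, (i : ℕ) ≤ r → f i = i) ∧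
      (∀ x : ℕ+, (x : ℕ) ∈ K → x ∈ Set.range f) ∧
      ∀ i : ℕ+, (f i : ℕ) ∈ K ↔ (i : ℕ) ∈ Finset.Ioc r (r + K.card) := by
  classical
  -- `f` enumerates `{0, …, r} ∪ K ∪ (m, ∞)`. Keeping `0` makes the enumeration fix each `i ≤ r`;
  -- the tail beyond `m` makes the set infinite.
  set p : ℕ → Prop := fun i => i ≤ r ∨ i ∈ K ∨ m < i with hp
  have hinf : (Set.ofPred p).Infinite :=
    (Set.Ioi_infinite m).mono fun i hi => Or.inr (Or.inr hi)
  have hmono := Nat.nth_strictMono hinf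
  have hfix : ∀ i ≤ r, Nat.nth p i = i := by
    intro i hi
    have hcount : Nat.count p i = i := Nat.count_iff_forall.2 fun j hj => Or.inl (by omega)
    have := Nat.nth_count (p := p) (n := i) (Or.inl hi)
    rwa [hcount] at this
  have hcount : Nat.count p (m + 1) = r + 1 + K.card := by
    have hfilter : (Finset.range (m + 1)).filter p = Finset.range (r + 1) ∪ K := by
      ext i
      have : i ∈ K → r < i ∧ i ≤ m := fun hi => Finset.mem_Ioc.1 (hK hi)
      simp only [hp, Finset.mem_filter, Finset.mem_range, Finset.mem_union]
      grind
    have hdisj : Disjoint (Finset.range (r + 1)) K := by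
      rw [Finset.disjoint_left]
      intro i hi hiK
      have := Finset.mem_Ioc.1 (hK hiK)
      have := Finset.mem_range.1 hi
      omega
    rw [Nat.count_eq_card_filter_range, hfilter, Finset.card_union_of_disjoint hdisj,
      Finset.card_range]
  have hle : ∀ i, Nat.nth p i ≤ m ↔ i ≤ r + K.card := by
    intro i
    have := Nat.count_le_iff_le_nth hinf (a := m + 1) (b := i)
    omega
  have hgt : ∀ i, r < Nat.nth p i ↔ r < i := by
    intro i
    conv_lhs => rw [← hfix r le_rfl]
    exact hmono.lt_iff_lt
  refine ⟨fun i => ⟨Nat.nth p i, i.pos.trans_le hmono.le_apply⟩, fun i j h => hmono h,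
    fun i hi => PNat.eq (hfix i hi), fun x hx => ?_, fun i => ?_⟩
  · have hpx : Nat.nth p (Nat.count p x) = x := Nat.nth_count (Or.inr (Or.inl hx))
    have hpos : 0 < Nat.count p x := by
      rcases Nat.eq_zero_or_pos (Nat.count p x) with h | h
      · rw [h, hfix 0 (Nat.zero_le r)] at hpx
        exact absurd hpx x.pos.ne
      · exact h
    exact ⟨⟨Nat.count p x, hpos⟩, PNat.eq hpx⟩
  · change Nat.nth p i ∈ K ↔ _
    rw [Finset.mem_Ioc, ← hle, ← hgt]
    constructor
    · exact fun h => Finset.mem_Ioc.1 (hK h)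
    · rintro ⟨h₁, h₂⟩
      have h₃ : p (Nat.nth p i) := Nat.nth_mem_of_infinite hinf i
      rcases h₃ with h | h | h
      · omega
      · exact h
      · omega

theorem take_rsTableau_map {f : ℕ+ → ℕ+} (hf : StrictMono f) {r : ℕ} {w : Word}
    (h : ∀ R ∈ (rsTableau w).take r, ∀ x ∈ R, f x = x) :
    (rsTableau (w.map f)).take r = (rsTableau w).take r := by
  rw [rsTableau_map hf, ← List.map_take]
  conv_rhs => rw [← List.map_id ((rsTableau w).take r)]
  refine List.map_congr_left fun R hR => ?_
  conv_rhs => rw [id, ← List.map_id R]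
  exact List.map_congr_left (h R hR)

/-! ### Counting by the set of large letters -/

/-- The words of length `n` in `C` whose set of letters larger than `r` is `K`. -/
def wordsWithLargeLetters (C : Set Word) (r n : ℕ) (K : Finset ℕ) : Set Word :=
  {w | w ∈ C ∧ w.length = n ∧ largeLetters r w = K}

section Counting

variable {C : Set Word} {r n m : ℕ}

/-- Relabelling by `f` fixes the small letters, hence the first `r` rows of the tableau, so it is a
bijection between the two sets. -/
theorem ncard_wordsWithLargeLetters
    (hC : ∀ w ∈ C, ∀ R ∈ (rsTableau w).take r, ∀ x ∈ R, (x : ℕ) ≤ r)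
    (hC' : ∀ w ∈ C, ∀ w', (rsTableau w').take r = (rsTableau w).take r → w' ∈ C)
    {K : Finset ℕ} (hK : K ⊆ Finset.Ioc r m) (hrm : r ≤ m) :
    (wordsWithLargeLetters C r n K).ncard =
      (wordsWithLargeLetters C r n (Finset.Ioc r (r + K.card))).ncard := by
  obtain ⟨f, hf, hfix, hrange, hmem⟩ := exists_strictMono_relabelling hK hrm
  have hlarge : ∀ w : Word, largeLetters r (w.map f) = K ↔
      largeLetters r w = Finset.Ioc r (r + K.card) := by
    intro w
    have hgt : ∀ i : ℕ+, r < (f i : ℕ) ↔ r < (i : ℕ) := by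
      intro i
      refine ⟨fun h => ?_, fun h => h.trans_le hf.le_apply⟩
      by_contra hi
      rw [hfix i (not_lt.1 hi)] at h
      exact hi h
    constructor
    · intro h
      ext x
      constructor
      · intro hx
        obtain ⟨⟨a, ha, rfl⟩, hrx⟩ := mem_largeLetters.1 hx
        rw [← hmem, ← h, coe_mem_largeLetters]
        exact ⟨List.mem_map_of_mem ha, (hgt a).2 hrx⟩
      · intro hx
        have hpos : 0 < x := by have := (Finset.mem_Ioc.1 hx).1; omega
        lift x to ℕ+ using hpos
        have hx' := (hmem x).2 hx
        rw [← h, coe_mem_largeLetters, List.mem_map_of_injective hf.injective, hgt] at hx'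
        exact coe_mem_largeLetters.2 hx'
    · intro h
      ext x
      constructor
      · intro hx
        obtain ⟨⟨b, hb, rfl⟩, hrx⟩ := mem_largeLetters.1 hx
        obtain ⟨a, ha, rfl⟩ := List.mem_map.1 hb
        rw [hmem, ← h, coe_mem_largeLetters]
        exact ⟨ha, (hgt a).1 hrx⟩
      · intro hx
        have hpos : 0 < x := by have := (Finset.mem_Ioc.1 (hK hx)).1; omega
        lift x to ℕ+ using hpos
        obtain ⟨a, rfl⟩ := hrange x hx
        have ha := (hmem a).1 hx
        rw [← h, coe_mem_largeLetters] at ha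
        exact coe_mem_largeLetters.2 ⟨List.mem_map_of_mem ha.1, (hgt a).2 ha.2⟩
  rw [← Set.ncard_image_of_injective
    (wordsWithLargeLetters C r n (Finset.Ioc r (r + K.card))) (List.map_injective_iff.2 hf.injective)]
  congr 1
  ext w
  constructor
  · rintro ⟨hw, hn, hwK⟩
    have hw' : w ∈ Set.range (List.map f) := by
      rw [Set.range_list_map]
      intro x hx
      by_cases hxr : (x : ℕ) ≤ r
      · exact ⟨x, hfix x hxr⟩
      · refine hrange x ?_
        rw [← hwK, coe_mem_largeLetters]
        exact ⟨hx, not_le.1 hxr⟩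
    obtain ⟨v, rfl⟩ := hw'
    refine ⟨v, ⟨hC' _ hw v ?_, by simpa using hn, (hlarge v).1 hwK⟩, rfl⟩
    refine (take_rsTableau_map hf fun R hR x hx => hfix x ?_).symm
    -- The bound is known for the relabelled tableau; it descends to `v` because `x ≤ f x`.
    have hCw := hC _ hw
    rw [rsTableau_map hf, ← List.map_take] at hCw
    have h₁ : (f x : ℕ) ≤ r := hCw _ (List.mem_map_of_mem hR) _ (List.mem_map_of_mem hx)
    have h₂ : (x : ℕ) ≤ f x := hf.le_apply
    omega
  · rintro ⟨v, ⟨hv, hn, hvK⟩, rfl⟩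
    refine ⟨hC' v hv _ ?_, by simpa using hn, (hlarge v).2 hvK⟩
    exact take_rsTableau_map hf fun R hR x hx => hfix x (hC v hv R hR x hx)

theorem finite_words (n m : ℕ) : {w : Word | w.length = n ∧ ∀ a ∈ w, (a : ℕ) ≤ m}.Finite := by
  have hfin : {a : ℕ+ | (a : ℕ) ≤ m}.Finite :=
    Set.Finite.of_finite_image ((Set.finite_Iic m).subset (by rintro _ ⟨a, ha, rfl⟩; exact ha))
      PNat.coe_injective.injOn
  have := hfin.to_subtype
  refine ((List.finite_length_eq {a : ℕ+ | (a : ℕ) ≤ m} n).image (List.map (↑))).subset ?_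
  rintro w ⟨hn, hw⟩
  have hw' : w ∈ Set.range (List.map ((↑) : {a : ℕ+ | (a : ℕ) ≤ m} → ℕ+)) := by
    rw [Set.range_list_map]
    exact fun x hx => ⟨⟨x, hw x hx⟩, rfl⟩
  obtain ⟨v, rfl⟩ := hw'
  exact ⟨v, by simpa using hn, rfl⟩

theorem le_of_largeLetters_subset {w : Word} (hrm : r ≤ m)
    (h : largeLetters r w ⊆ Finset.Ioc r m) : ∀ a ∈ w, (a : ℕ) ≤ m := by
  intro a ha
  by_cases har : (a : ℕ) ≤ r
  · exact har.trans hrm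
  · exact (Finset.mem_Ioc.1 (h (coe_mem_largeLetters.2 ⟨ha, not_le.1 har⟩))).2

theorem finite_wordsWithLargeLetters {K : Finset ℕ} (hK : K ⊆ Finset.Ioc r m) (hrm : r ≤ m) :
    (wordsWithLargeLetters C r n K).Finite :=
  (finite_words n m).subset fun _ hw =>
    ⟨hw.2.1, le_of_largeLetters_subset hrm (hw.2.2.symm ▸ hK)⟩

/-- The words are fibred over their sets of large letters, and `{r + 1, …, m}` has `(m - r).choose
k` subsets of size `k`. -/
theorem ncard_eq_sum_choose (hC : ∀ w ∈ C, ∀ R ∈ (rsTableau w).take r, ∀ x ∈ R, (x : ℕ) ≤ r)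
    (hC' : ∀ w ∈ C, ∀ w', (rsTableau w').take r = (rsTableau w).take r → w' ∈ C) (hrm : r ≤ m) :
    {w | w ∈ C ∧ w.length = n ∧ ∀ a ∈ w, (a : ℕ) ≤ m}.ncard =
      ∑ k ∈ Finset.range (m - r + 1), (m - r).choose k *
        (wordsWithLargeLetters C r n (Finset.Ioc r (r + k))).ncard := by
  have hfin : {w | w ∈ C ∧ w.length = n ∧ ∀ a ∈ w, (a : ℕ) ≤ m}.Finite :=
    (finite_words n m).subset fun _ hw => hw.2
  have hmaps : (hfin.toFinset : Set Word).MapsTo (largeLetters r)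
      ((Finset.Ioc r m).powerset : Finset (Finset ℕ)) := by
    intro w hw
    rw [Finset.mem_coe, Set.Finite.mem_toFinset] at hw
    rw [Finset.mem_coe, Finset.mem_powerset]
    intro x hx
    obtain ⟨⟨a, ha, rfl⟩, hra⟩ := mem_largeLetters.1 hx
    exact Finset.mem_Ioc.2 ⟨hra, hw.2.2 a ha⟩
  rw [Set.ncard_eq_toFinset_card _ hfin, Finset.card_eq_sum_card_fiberwise hmaps]
  have hfiber : ∀ K ∈ (Finset.Ioc r m).powerset,
      (hfin.toFinset.filter fun w => largeLetters r w = K).card =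
        (wordsWithLargeLetters C r n (Finset.Ioc r (r + K.card))).ncard := by
    intro K hK
    rw [Finset.mem_powerset] at hK
    rw [← ncard_wordsWithLargeLetters hC hC' hK hrm, ← Set.ncard_coe_finset]
    congr 1
    ext w
    simp only [Finset.coe_filter, Set.Finite.mem_toFinset, Set.mem_ofPred_eq,
      wordsWithLargeLetters]
    constructor
    · rintro ⟨⟨h₁, h₂, _⟩, h₃⟩
      exact ⟨h₁, h₂, h₃⟩
    · rintro ⟨h₁, h₂, h₃⟩
      exact ⟨⟨h₁, h₂, le_of_largeLetters_subset hrm (h₃.symm ▸ hK)⟩, h₃⟩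
  rw [Finset.sum_congr rfl hfiber, Finset.sum_powerset_apply_card
    (fun k => (wordsWithLargeLetters C r n (Finset.Ioc r (r + k))).ncard)]
  simp

theorem wordsWithLargeLetters_eq_empty (hr : 0 < r)
    (hC : ∀ w ∈ C, ∀ R ∈ (rsTableau w).take r, ∀ x ∈ R, (x : ℕ) ≤ r) {k : ℕ} (hk : n - r < k) :
    wordsWithLargeLetters C r n (Finset.Ioc r (r + k)) = ∅ := by
  refine Set.eq_empty_of_forall_notMem ?_
  rintro w ⟨hw, hn, hwk⟩
  have hcard : (largeLetters r w).card = k := by simp [hwk]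
  have := (card_largeLetters_add_le hr (hC w hw) (Finset.card_pos.1 (by omega))).1
  omega

theorem decreasingWord_mem_wordsWithLargeLetters (hn : decreasingWord n ∈ C) :
    decreasingWord n ∈ wordsWithLargeLetters C r n (Finset.Ioc r n) := by
  refine ⟨hn, length_decreasingWord n, ?_⟩
  ext x
  rw [mem_largeLetters, Finset.mem_Ioc]
  constructor
  · rintro ⟨⟨a, ha, rfl⟩, h⟩
    exact ⟨h, mem_decreasingWord.1 ha⟩
  · rintro ⟨h₁, h₂⟩
    exact ⟨⟨⟨x, by omega⟩, mem_decreasingWord.2 h₂, rfl⟩, h₁⟩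

theorem wordsWithLargeLetters_subset_singleton (hr : 0 < r)
    (hC : ∀ w ∈ C, ∀ R ∈ (rsTableau w).take r, ∀ x ∈ R, (x : ℕ) ≤ r) (hrn : r ≤ n)
    (hcase : r < n ∨ r = 1) :
    wordsWithLargeLetters C r n (Finset.Ioc r n) ⊆ {decreasingWord n} := by
  rintro w ⟨hw, hn, hwn⟩
  refine eq_decreasingWord ?_ hn (le_of_largeLetters_subset hrn hwn.subset)
  rcases hrn.lt_or_eq with h | rfl
  · have hcard : (largeLetters r w).card = n - r := by simp [hwn]
    exact (card_largeLetters_add_le hr (hC w hw) (Finset.card_pos.1 (by omega))).2 (by omega)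
  -- When `n = r` there is no large letter and the equality case is unavailable, but a one-letter
  -- word is trivially decreasing.
  · obtain rfl : r = 1 := by omega
    obtain ⟨a, rfl⟩ := List.length_eq_one_iff.1 hn
    simp

end Counting

/-! ### The polynomial -/

open Polynomial in
/-- A sum of binomial coefficients in `t - r` is a polynomial in `t`. -/
theorem exists_polynomial_eval_eq_sum_choose (r d : ℕ) (N : ℕ → ℕ) (hd : N d ≠ 0) :
    ∃ p : ℚ[X], (∀ m : ℕ, r ≤ m →
        ((∑ k ∈ Finset.range (d + 1), (m - r).choose k * N k : ℕ) : ℚ) = p.eval (m : ℚ)) ∧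
      p.degree = d ∧ p.leadingCoeff = N d / (d.factorial : ℚ) := by
  -- `(m - r).choose k` is the falling factorial of `m - r` divided by `k!`; the natural subtraction
  -- is genuine since `r ≤ m`.
  set q : ℕ → ℚ[X] := fun k => (descPochhammer ℚ k).comp (X - C (r : ℚ)) with hq
  set c : ℕ → ℚ := fun k => N k / (k.factorial : ℚ) with hc
  have hmonic : ∀ k, (q k).Monic := fun k => (monic_descPochhammer ℚ k).comp_X_sub_C _
  have hdegq : ∀ k, (q k).degree = k := by
    intro k
    rw [degree_eq_natDegree (hmonic k).ne_zero, hq, natDegree_comp, natDegree_X_sub_C,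
      descPochhammer_natDegree, mul_one]
  have hcd : c d ≠ 0 := by
    simp only [hc]
    positivity
  have hlead : (C (c d) * q d).degree = d := by rw [degree_C_mul hcd, hdegq]
  have hlow : (∑ k ∈ Finset.range d, C (c k) * q k).degree < (C (c d) * q d).degree := by
    rw [hlead]
    refine (degree_sum_le _ _).trans_lt ((Finset.sup_lt_iff (WithBot.bot_lt_coe d)).2 ?_)
    intro k hk
    rcases eq_or_ne (c k) 0 with h | h
    · simp [h]
    · rw [degree_C_mul h, hdegq]
      exact WithBot.coe_lt_coe.2 (Finset.mem_range.1 hk)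
  refine ⟨∑ k ∈ Finset.range (d + 1), C (c k) * q k, fun m hm => ?_, ?_, ?_⟩
  · rw [Nat.cast_sum, eval_finsetSum]
    refine Finset.sum_congr rfl fun k _ => ?_
    have hfac : (k.factorial : ℚ) ≠ 0 := by positivity
    simp only [hq, hc, eval_mul, eval_C, eval_comp, eval_sub, eval_X]
    rw [← Nat.cast_sub hm, descPochhammer_eval_eq_descFactorial,
      Nat.descFactorial_eq_factorial_mul_choose]
    push_cast
    field_simp
  · rw [Finset.sum_range_succ, degree_add_eq_right_of_degree_lt hlow, hlead]
  · rw [Finset.sum_range_succ, leadingCoeff_add_of_degree_lt hlow, leadingCoeff_mul,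
      leadingCoeff_C, (hmonic d).leadingCoeff, mul_one]

theorem mainTheorem10 (u : Word) (r : ℕ) (hr : 0 < r)
    -- (a) the first `r` rows of `P(w)`, for `w ∈ C(u)`, only contain elements at most `r`
    (ha : ∀ w ∈ placticCentralizer u,
      ∀ R ∈ (insertionTableau w).take r, ∀ x ∈ R, x ≤ r)
    -- (b) the remaining rows can be any semistandard tableau with entries greater than `r`
    (hb : ∀ w ∈ placticCentralizer u,
      ∀ (μ : YoungDiagram) (T : SemistandardYoungTableau μ),
        T.rows.take r = (insertionTableau w).take r →
        (∀ R ∈ T.rows.drop r, ∀ x ∈ R, r < x) →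
        ∃ w' ∈ placticCentralizer u, insertionTableau w' = T.rows)
    (n : ℕ) (hn : r ≤ n) :
    ∃ p : Polynomial ℚ,
      (∀ m : ℕ, n ≤ m → (centralizerCount n m u : ℚ) = p.eval (m : ℚ)) ∧
      p.degree = ((n - r : ℕ) : WithBot ℕ) ∧
      (r < n ∨ r = 1 → p.leadingCoeff = 1 / ((n - r).factorial : ℚ)) := by
  have hC : ∀ w ∈ placticCentralizer u, ∀ R ∈ (rsTableau w).take r, ∀ x ∈ R, (x : ℕ) ≤ r :=
    fun w hw => le_of_mem_take_rsTableau (ha w hw)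
  have hC' : ∀ w ∈ placticCentralizer u, ∀ w',
      (rsTableau w').take r = (rsTableau w).take r → w' ∈ placticCentralizer u :=
    fun w hw w' h => mem_placticCentralizer_of_take_eq hb hw h
  set N : ℕ → ℕ := fun k =>
    (wordsWithLargeLetters (placticCentralizer u) r n (Finset.Ioc r (r + k))).ncard with hN
  have hdec : decreasingWord n ∈ placticCentralizer u := by
    refine hC' _ (decreasingWord_mem_placticCentralizer hr ha) _ ?_
    rw [rsTableau_decreasingWord, rsTableau_decreasingWord, ← List.map_take, ← List.map_take,
      List.take_range, List.take_range, min_eq_left hn, min_self]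
  have hmem := decreasingWord_mem_wordsWithLargeLetters (r := r) hdec
  have hNd : N (n - r) =
      (wordsWithLargeLetters (placticCentralizer u) r n (Finset.Ioc r n)).ncard := by
    simp only [hN, Nat.add_sub_cancel' hn]
  have hNd0 : N (n - r) ≠ 0 := by
    rw [hNd]
    exact (Set.ncard_pos (finite_wordsWithLargeLetters subset_rfl hn)).2 ⟨_, hmem⟩ |>.ne'
  obtain ⟨p, hp, hdeg, hlc⟩ := exists_polynomial_eval_eq_sum_choose r (n - r) N hNd0
  refine ⟨p, fun m hm => ?_, hdeg, fun hcase => ?_⟩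
  · rw [← hp m (hn.trans hm), centralizerCount, ncard_eq_sum_choose hC hC' (hn.trans hm)]
    congr 1
    -- As `n ≤ m`, the sum up to `m - r` extends the one up to `n - r` only by vanishing terms.
    refine (Finset.sum_subset (Finset.range_mono (by omega)) fun k _ hk => ?_).symm
    rw [Finset.mem_range, not_lt] at hk
    rw [wordsWithLargeLetters_eq_empty hr hC (by omega), Set.ncard_empty, mul_zero]
  · have hsing : wordsWithLargeLetters (placticCentralizer u) r n (Finset.Ioc r n) =
        {decreasingWord n} :=
      (wordsWithLargeLetters_subset_singleton hr hC hn hcase).antisymm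
        (Set.singleton_subset_iff.2 hmem)
    rw [hlc, hNd, hsing, Set.ncard_singleton, Nat.cast_one]
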